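/- Let $\sigma_1,\sigma_2$ be the substitutions on the alphabet $\{1,2\}$ given by $\sigma_1: 1\mapsto 1,\ 2\mapsto 12$ and $\sigma_2: 1\mapsto 21,\ 2\mapsto 2$, extended to finite words as morphisms for concatenation. A sequence of finite words $(u_n)_n$ converges to an infinite word $w$ if every prefix of $w$ is a prefix of $u_n$ for all sufficiently large $n$. An infinite word $w$ is Sturmian if for every $n\in\mathbb{N}$ it has exactly $n+1$ distinct factors (blocks of consecutive letters) of length $n$. The frequency of the letter $a$ in $w$ is $\lim_{n\to\infty}\frac1n|\mathrm{pref}_n(w)|_a$, if this limit exists, where $|\mathrm{pref}_n(w)|_a$ is the number of occurrences of $a$ among the first $n$ letters of $w$. Theorem. Let $(s_n)_{n\ge 1}\in\{\sigma_1,\sigma_2\}^{\mathbb{N}_{\ge 1}}$ be a sequence in which both $\sigma_1$ and $\sigma_2$ occur infinitely often. Then: (i) the two sequences of finite words $(s_1\circ s_2\circ\cdots\circ s_n(1))_n$ and $(s_1\circ s_2\circ\cdots\circ s_n(2))_n$ converge, as $n\to\infty$, to the same infinite word $w_0$, and $w_0$ is Sturmian; (ii) the letters $1$ and $2$ have frequencies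 $f_1$ and $f_2$ in $w_0$, with $f_2\neq 0$, and if $(b_k)_{k\ge 0}$ is the run-length sequence of $(s_n)_n$ (that is, $b_0\ge 0$ is the number of times $\sigma_1$ is repeated before the first occurrence of $\sigma_2$, $b_1\geq 1$ is the number of times $\sigma_2$ is then repeated before the next occurrence of $\sigma_1$, and so on, so that $s_1s_2s_3\cdots=\sigma_1^{b_0}\sigma_2^{b_1}\sigma_1^{b_2}\sigma_2^{b_3}\cdots$), then $[b_0;b_1,b_2,b_3,\ldots]$ is the continued fraction expansion of $f_1/f_2$. -/

import Mathlib

open Filter Topology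

namespace SturmianWords

/-- The binary alphabet `{1, 2}`. -/
inductive Letter where
  | one
  | two
  deriving DecidableEq

section Words

variable {α : Type*}

/-- The block of `n` consecutive letters of the infinite word `w` starting at position `i`. -/
def block (w : ℕ → α) (i n : ℕ) : List α :=
  (List.range n).map fun k => w (i + k)

/-- The prefix of length `n` of the infinite word `w`. -/
def pref (w : ℕ → α) (n : ℕ) : List α :=
  block w 0 n

/-- The set `ℒₙ(w)` of factors of length `n` of the infinite word `w`. -/
def factors (w : ℕ → α) (n : ℕ) : Set (List α) :=
  {u | ∃ i, u = block w i n}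

/-- The complexity function of an infinite word: the number of its factors of length `n`. -/
noncomputable def complexity (w : ℕ → α) (n : ℕ) : ℕ :=
  (factors w n).ncard

/-- Sturmian words: infinite words of complexity `n ↦ n + 1`. -/
def IsSturmian (w : ℕ → α) : Prop :=
  ∀ n, complexity w n = n + 1

/-- The finite words `u n` converge to the infinite word `w`: they share larger and larger
prefixes with `w`, i.e. each prefix of `w` is a prefix of `u n` for all large `n`. -/
def ConvergesTo (u : ℕ → List α) (w : ℕ → α) : Prop :=
  ∀ N, ∀ᶠ n in atTop, pref w N <+: u n

/-- The letter `a` has frequency `f` in the infinite word `w`. -/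
def HasFrequency [DecidableEq α] (w : ℕ → α) (a : α) (f : ℝ) : Prop :=
  Tendsto (fun n : ℕ => ((pref w n).count a : ℝ) / n) atTop (𝓝 f)

end Words

/-- A substitution: a map from the alphabet to the finite words. -/
abbrev Substitution := Letter → List Letter

/-- The image of a finite word by a substitution, extended as a morphism for concatenation. -/
def Substitution.apply (s : Substitution) (u : List Letter) : List Letter :=
  u.flatMap s

/-- `σ₁ : 1 ↦ 1, 2 ↦ 12`. -/
def sigma1 : Substitution
  | .one => [.one]
  | .two => [.one, .two]

/-- `σ₂ : 1 ↦ 21, 2 ↦ 2`. -/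
def sigma2 : Substitution
  | .one => [.two, .one]
  | .two => [.two]

/-- The image of the finite word `u` by the composition of the first `n` substitutions of the
sequence, the first one being applied last: `(s 0 ∘ s 1 ∘ ⋯ ∘ s (n - 1)) u`. -/
def compose (s : ℕ → Substitution) : ℕ → List Letter → List Letter
  | 0, u => u
  | n + 1, u => compose s n (Substitution.apply (s n) u)

/-- The substitution repeated in the `k`-th run: `σ₁` for even `k`, `σ₂` for odd `k`. -/
def runValue (k : ℕ) : Substitution :=
  if Even k then sigma1 else sigma2

/-- The position at which the `k`-th run starts (runs are numbered from `0`, and the `0`-th run,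
consisting of `σ₁`'s, may be empty): the run `k + 1` starts at the first position, from the start
of the run `k` on, that does not carry the substitution of the run `k`. -/
noncomputable def runStart (s : ℕ → Substitution) : ℕ → ℕ
  | 0 => 0
  | k + 1 => sInf {n | runStart s k ≤ n ∧ s n ≠ runValue k}

/-- The run-length sequence: the number of times `σ₁` is repeated before the first `σ₂`, then the
number of times `σ₂` is repeated before the next `σ₁`, and so on. -/
noncomputable def runLength (s : ℕ → Substitution) (k : ℕ) : ℕ :=
  runStart s (k + 1) - runStart s k

/-- `[b 0; b 1, b 2, …]` is the (infinite) continued fraction expansion of the real number `x`,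
as computed by the algorithm of successive integer and fractional parts. -/
def IsContFractExpansion (b : ℕ → ℕ) (x : ℝ) : Prop :=
  (GenContFract.of x).h = b 0 ∧
    ∀ n, (GenContFract.of x).s.get? n = some ⟨1, (b (n + 1) : ℝ)⟩

end SturmianWords

open SturmianWords

namespace SturmianWords

/-! Write each substitution as `sub a`, directed by a letter sequence `d`, and let `word d n a` be
the image of `a` under the first `n` of them. Step `n` fixes the image of `d n` and puts it in front
of the other image. Convergence: from step `n + 1` on, both images begin with `word d n (d n)`.
Sturmian: every prefix of the limit is left special. No other factor is, since two such words of
equal length, first differing after `x`, would give factors `axa` and `bxb`; desubstitution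
(`exists_infix_of_infix_sub_apply`) pulls such a pair back to a single letter. Frequencies: the
frequencies of `1` in the two images bound shrinking intervals, the determinant being `1`; a long
prefix is a concatenation of images up to a bounded error. Continued fraction: undoing `sub a`
lowers the ratio of `a` to the other letter by one, and changing run inverts it, which is the
continued fraction algorithm on `f₁ / f₂`. -/

/-- The other letter. -/
def Letter.other : Letter → Letter
  | .one => .two
  | .two => .one

@[simp] theorem Letter.other_other (a : Letter) : a.other.other = a := by cases a <;> rfl

@[simp] theorem Letter.other_ne (a : Letter) : a.other ≠ a := by cases a <;> decide

@[simp] theorem Letter.ne_other (a : Letter) : a ≠ a.other := by cases a <;> decide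

theorem Letter.eq_other_of_ne {a b : Letter} (h : b ≠ a) : b = a.other := by
  cases a <;> cases b <;> first | rfl | exact absurd rfl h

instance : Finite Letter :=
  Finite.of_injective (fun a : Letter => decide (a = .one)) fun a b h => by
    cases a <;> cases b <;> simp_all

/-! ### Substitutions directed by letters -/

/-- The substitution fixing `a` and inserting `a` before the other letter. -/
def sub (a : Letter) : Substitution := fun b => if b = a then [a] else [a, b]

theorem sub_one : sub .one = sigma1 := by
  funext b; cases b <;> rfl

theorem sub_two : sub .two = sigma2 := by
  funext b; cases b <;> rfl

theorem sub_injective : Function.Injective sub := by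
  intro a b h
  by_contra hab
  have := congrFun h a
  simp [sub, hab] at this

theorem Substitution.apply_append (s : Substitution) (u v : List Letter) :
    s.apply (u ++ v) = s.apply u ++ s.apply v := by
  simp [Substitution.apply]

@[simp] theorem sub_apply_nil (a : Letter) : (sub a).apply [] = [] := rfl

@[simp] theorem sub_apply_cons_self (a : Letter) (u : List Letter) :
    (sub a).apply (a :: u) = a :: (sub a).apply u := by
  simp [Substitution.apply, sub]

theorem sub_apply_cons_of_ne {a b : Letter} (h : b ≠ a) (u : List Letter) :
    (sub a).apply (b :: u) = a :: b :: (sub a).apply u := by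
  simp [Substitution.apply, sub, h]

theorem compose_append (s : ℕ → Substitution) (n : ℕ) (u v : List Letter) :
    compose s n (u ++ v) = compose s n u ++ compose s n v := by
  induction n generalizing u v with
  | zero => rfl
  | succ n ih => simp only [compose, Substitution.apply_append, ih]

@[simp] theorem compose_nil (s : ℕ → Substitution) (n : ℕ) : compose s n [] = [] := by
  induction n with
  | zero => rfl
  | succ n ih => simpa [compose, Substitution.apply] using ih

theorem compose_succ_left (s : ℕ → Substitution) (n : ℕ) (u : List Letter) :
    compose s (n + 1) u = (s 0).apply (compose (fun k => s (k + 1)) n u) := by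
  induction n generalizing u with
  | zero => rfl
  | succ n ih => rw [compose, ih]; rfl

/-- The image of the letter `a` by the composition of `n` substitutions directed by `d`. -/
def word (d : ℕ → Letter) (n : ℕ) (a : Letter) : List Letter :=
  compose (fun k => sub (d k)) n [a]

section Word

variable (d : ℕ → Letter)

@[simp] theorem word_zero (a : Letter) : word d 0 a = [a] := rfl

theorem compose_cons (n : ℕ) (a : Letter) (u : List Letter) :
    compose (fun k => sub (d k)) n (a :: u) =
      word d n a ++ compose (fun k => sub (d k)) n u := by
  rw [← List.singleton_append, compose_append]; rfl

theorem word_succ_self (n : ℕ) : word d (n + 1) (d n) = word d n (d n) := by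
  simp [word, compose]

theorem word_succ_of_ne {n : ℕ} {a : Letter} (h : a ≠ d n) :
    word d (n + 1) a = word d n (d n) ++ word d n a := by
  rw [word, compose, sub_apply_cons_of_ne h, compose_cons]; rfl

theorem word_succ_left (n : ℕ) (a : Letter) :
    word d (n + 1) a = (sub (d 0)).apply (word (fun k => d (k + 1)) n a) :=
  compose_succ_left _ n [a]

/-- Strictness matters: only after step `n` has the image of the other letter received this prefix.
-/
theorem word_prefix_word {n m : ℕ} (h : n < m) (a : Letter) :
    word d n (d n) <+: word d m a := by
  induction m, h using Nat.le_induction generalizing a with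
  | base =>
    by_cases ha : a = d n
    · rw [ha, word_succ_self]
    · rw [word_succ_of_ne d ha]; exact List.prefix_append _ _
  | succ m _ ih =>
    by_cases ha : a = d m
    · rw [ha, word_succ_self]; exact ih _
    · rw [word_succ_of_ne d ha]; exact (ih _).trans (List.prefix_append _ _)

theorem word_suffix_word {n m : ℕ} (h : n ≤ m) (a : Letter) : word d n a <:+ word d m a := by
  induction m, h using Nat.le_induction with
  | base => exact List.suffix_rfl
  | succ m _ ih =>
    by_cases ha : a = d m
    · subst ha; rw [word_succ_self]; exact ih
    · rw [word_succ_of_ne d ha]; exact ih.trans (List.suffix_append _ _)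

theorem singleton_suffix_word (n : ℕ) (a : Letter) : [a] <:+ word d n a :=
  word_suffix_word d n.zero_le a

theorem length_word_pos (n : ℕ) (a : Letter) : 0 < (word d n a).length :=
  (singleton_suffix_word d n a).length_le

theorem length_word_mono {n m : ℕ} (h : n ≤ m) (a : Letter) :
    (word d n a).length ≤ (word d m a).length :=
  (word_suffix_word d h a).length_le

variable {d}

theorem eventually_le_length_word (hd : ∀ a, ∃ᶠ n in atTop, d n = a) (N : ℕ) (a : Letter) :
    ∀ᶠ n in atTop, N ≤ (word d n a).length := by
  induction N with
  | zero => simp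
  | succ N ih =>
    obtain ⟨n₀, h₀⟩ := eventually_atTop.1 ih
    obtain ⟨n, hn, hda⟩ := frequently_atTop.1 (hd a.other) n₀
    filter_upwards [eventually_ge_atTop (n + 1)] with m hm
    have h := length_word_mono d hm a
    rw [word_succ_of_ne d (by rw [hda]; simp), List.length_append] at h
    have := length_word_pos d n (d n)
    have := h₀ n hn
    omega

end Word

/-! ### Factors and limits of prefix chains -/

section Limit

variable {α : Type*}

@[simp] theorem length_block (w : ℕ → α) (i n : ℕ) : (block w i n).length = n := by
  simp [block]

@[simp] theorem length_pref (w : ℕ → α) (n : ℕ) : (pref w n).length = n := by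
  simp [pref]

theorem block_succ (w : ℕ → α) (i n : ℕ) : block w i (n + 1) = w i :: block w (i + 1) n := by
  simp [block, List.range_succ_eq_map, Function.comp_def, Nat.add_assoc, Nat.add_comm 1]

theorem block_add (w : ℕ → α) (i m n : ℕ) :
    block w i (m + n) = block w i m ++ block w (i + m) n := by
  simp [block, List.range_add, Function.comp_def, Nat.add_assoc]

theorem pref_prefix_pref (w : ℕ → α) {m n : ℕ} (h : m ≤ n) : pref w m <+: pref w n := by
  obtain ⟨k, rfl⟩ := Nat.exists_eq_add_of_le h
  rw [pref, pref, block_add]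
  exact List.prefix_append _ _

theorem block_infix_pref (w : ℕ → α) (i n : ℕ) : block w i n <:+: pref w (i + n) := by
  rw [pref, block_add, Nat.zero_add]
  exact (List.suffix_append _ _).isInfix

theorem mem_factors_of_infix_pref {w : ℕ → α} {u : List α} {N : ℕ} (h : u <:+: pref w N) :
    u ∈ factors w u.length := by
  obtain ⟨p, q, h⟩ := h
  refine ⟨p.length, ?_⟩
  have hN : N = p.length + u.length + q.length := by
    have := congrArg List.length h
    simp at this
    omega
  rw [hN, pref, block_add, block_add, Nat.zero_add] at h
  exact (List.append_inj (List.append_inj h (by simp)).1 (by simp)).2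

theorem exists_limit_of_prefix_chain {u : ℕ → List α} (hu : ∀ ⦃n m⦄, n < m → u n <+: u m)
    (hlen : ∀ N, ∃ n, N ≤ (u n).length) : ∃ w : ℕ → α, ∀ n, u n = pref w (u n).length := by
  choose k hk using fun i => hlen (i + 1)
  refine ⟨fun i => (u (k i))[i]'(hk i), fun n => ?_⟩
  refine List.ext_getElem (by simp) fun i h₁ h₂ => ?_
  simp only [pref, block, List.getElem_map, List.getElem_range, Nat.zero_add]
  rcases lt_trichotomy n (k i) with h | h | h
  · exact (hu h).getElem h₁
  · subst h; rfl
  · exact ((hu h).getElem (hk i)).symm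

end Limit

theorem exists_convergesTo_word {d : ℕ → Letter} (hd : ∀ a, ∃ᶠ n in atTop, d n = a) :
    ∃ w : ℕ → Letter, (∀ a, ConvergesTo (fun n => word d n a) w) ∧
      ∀ n, word d n (d n) = pref w (word d n (d n)).length := by
  have hlen : ∀ N, ∃ n, N ≤ (word d n (d n)).length := by
    intro N
    obtain ⟨n, h₁, h₂⟩ := ((eventually_le_length_word hd N .one).and
      (eventually_le_length_word hd N .two)).exists
    refine ⟨n, ?_⟩
    cases h : d n <;> assumption
  obtain ⟨w, hw⟩ := exists_limit_of_prefix_chain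
    (fun n m h => word_prefix_word d h (d m)) hlen
  refine ⟨w, fun a N => ?_, hw⟩
  obtain ⟨n, hn⟩ := hlen N
  filter_upwards [eventually_gt_atTop n] with m hm
  refine (pref_prefix_pref w hn).trans ?_
  rw [← hw n]
  exact word_prefix_word d hm a

/-! ### Desubstitution -/

theorem eq_of_sub_apply_eq_cons {a c : Letter} {u v : List Letter}
    (h : (sub a).apply u = c :: v) : c = a := by
  rcases u with _ | ⟨b, u⟩
  · simp at h
  · by_cases hb : b = a
    · subst hb; simp at h; exact h.1.symm
    · rw [sub_apply_cons_of_ne hb] at h; simp at h; exact h.1.symm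

theorem sub_apply_injective (a : Letter) : Function.Injective (sub a).apply := by
  intro u
  induction u with
  | nil =>
    rintro (_ | ⟨b, v⟩) h
    · rfl
    · by_cases hb : b = a
      · subst hb; simp at h
      · rw [sub_apply_cons_of_ne hb] at h; simp at h
  | cons c u ih =>
    rintro (_ | ⟨b, v⟩) h
    · by_cases hc : c = a
      · subst hc; simp at h
      · rw [sub_apply_cons_of_ne hc] at h; simp at h
    · by_cases hb : b = a <;> by_cases hc : c = a
      · subst hb hc
        simp at h
        rw [ih h]
      · subst hb
        rw [sub_apply_cons_of_ne hc, sub_apply_cons_self, List.cons.injEq] at h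
        exact absurd (eq_of_sub_apply_eq_cons h.2.symm) hc
      · subst hc
        rw [sub_apply_cons_of_ne hb, sub_apply_cons_self, List.cons.injEq] at h
        exact absurd (eq_of_sub_apply_eq_cons h.2) hb
      · rw [sub_apply_cons_of_ne hb, sub_apply_cons_of_ne hc] at h
        simp only [List.cons.injEq, true_and] at h
        rw [h.1, ih h.2]

/-- Every `a` in an image opens the image of a letter, so a cut before it lifts to `W`. -/
theorem exists_cut_of_sub_apply_eq {a : Letter} {W P Q : List Letter}
    (h : (sub a).apply W = P ++ a :: Q) :
    ∃ W₁ W₂, W = W₁ ++ W₂ ∧ (sub a).apply W₁ = P ∧ (sub a).apply W₂ = a :: Q := by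
  induction W generalizing P with
  | nil => simp at h
  | cons c W ih =>
    rcases P with _ | ⟨p, P⟩
    · exact ⟨[], c :: W, rfl, rfl, h⟩
    by_cases hc : c = a
    · subst hc
      simp only [sub_apply_cons_self, List.cons_append, List.cons.injEq] at h
      obtain ⟨W₁, W₂, rfl, h₁, h₂⟩ := ih h.2
      exact ⟨c :: W₁, W₂, rfl, by rw [sub_apply_cons_self, h₁, h.1], h₂⟩
    · rw [sub_apply_cons_of_ne hc, List.cons_append, List.cons.injEq] at h
      rcases P with _ | ⟨q, P⟩
      · simp only [List.nil_append, List.cons.injEq] at h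
        exact absurd h.2.1 hc
      · simp only [List.cons_append, List.cons.injEq] at h
        obtain ⟨W₁, W₂, rfl, h₁, h₂⟩ := ih h.2.2
        exact ⟨c :: W₁, W₂, rfl, by rw [sub_apply_cons_of_ne hc, h₁, h.1, h.2.1], h₂⟩

/-- The letter `b` arises only as the end of the block `ab`. -/
theorem exists_cut_of_sub_apply_eq_of_ne {a b : Letter} (hb : b ≠ a) {W P Q : List Letter}
    (h : (sub a).apply W = P ++ b :: Q) :
    ∃ W₁ W₂, W = W₁ ++ b :: W₂ ∧ P = (sub a).apply W₁ ++ [a] ∧ Q = (sub a).apply W₂ := by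
  induction W generalizing P with
  | nil => simp at h
  | cons c W ih =>
    rcases P with _ | ⟨p, P⟩
    · exact absurd (eq_of_sub_apply_eq_cons h) hb
    by_cases hc : c = a
    · subst hc
      simp only [sub_apply_cons_self, List.cons_append, List.cons.injEq] at h
      obtain ⟨W₁, W₂, rfl, h₁, h₂⟩ := ih h.2
      exact ⟨c :: W₁, W₂, rfl, by simp [h₁, h.1], h₂⟩
    · rw [sub_apply_cons_of_ne hc, List.cons_append, List.cons.injEq] at h
      rcases P with _ | ⟨q, P⟩
      · simp only [List.nil_append, List.cons.injEq] at h
        exact ⟨[], W, by simp [h.2.1], by simp [h.1], h.2.2.symm⟩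
      · simp only [List.cons_append, List.cons.injEq] at h
        obtain ⟨W₁, W₂, rfl, h₁, h₂⟩ := ih h.2.2
        exact ⟨c :: W₁, W₂, rfl, by rw [h₁, sub_apply_cons_of_ne hc, ← h.1, ← h.2.1]; rfl, h₂⟩

/-- No word `x` has both extensions `axa` and `bxb` in `W`, for distinct letters `a` and `b`. -/
def Separated (W : List Letter) : Prop :=
  ∀ ⦃x : List Letter⦄ ⦃a b : Letter⦄, a ≠ b → a :: (x ++ [a]) <:+: W → ¬ b :: (x ++ [b]) <:+: W

/-- Reading `bxb` forces `x = sub a (y) ++ [a]`, with `byb` in `W`. Then `axa` is the image of `ay`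
followed by `aa`; the first of these two letters is a full image, so `aya` lies in `W`. -/
theorem exists_infix_of_infix_sub_apply {a b : Letter} (hb : b ≠ a) {W x : List Letter}
    (ha : a :: (x ++ [a]) <:+: (sub a).apply W) (hb' : b :: (x ++ [b]) <:+: (sub a).apply W) :
    ∃ y, a :: (y ++ [a]) <:+: W ∧ b :: (y ++ [b]) <:+: W := by
  obtain ⟨P, Q, h⟩ := hb'
  obtain ⟨W₁, W₂, rfl, -, h₂⟩ := exists_cut_of_sub_apply_eq_of_ne (P := P)
    (Q := x ++ b :: Q) hb (by rw [← h]; simp)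
  obtain ⟨y, V, rfl, rfl, -⟩ := exists_cut_of_sub_apply_eq_of_ne hb h₂.symm
  refine ⟨y, ?_, W₁, V, by simp⟩
  obtain ⟨P', Q', h'⟩ := ha
  obtain ⟨U₁, U₂, hU, -, h₃⟩ := exists_cut_of_sub_apply_eq (P := P')
    (Q := (sub a).apply y ++ a :: a :: Q') (by rw [← h']; simp)
  obtain ⟨U₃, U₄, rfl, h₄, h₅⟩ := exists_cut_of_sub_apply_eq (P := a :: (sub a).apply y)
    (Q := a :: Q') h₃
  rw [← sub_apply_cons_self] at h₄
  obtain rfl := sub_apply_injective a h₄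
  rcases U₄ with _ | ⟨c, U₄⟩
  · simp at h₅
  by_cases hc : c = a
  · subst hc
    exact ⟨U₁, U₄, by rw [hU]; simp⟩
  · rw [sub_apply_cons_of_ne hc] at h₅
    simp only [List.cons.injEq, true_and] at h₅
    exact absurd h₅.1 hc

theorem Separated.sub_apply {W : List Letter} (hW : Separated W) (c : Letter) :
    Separated ((sub c).apply W) := by
  intro x a b hab ha hb
  by_cases h : a = c
  · subst h
    obtain ⟨y, h₁, h₂⟩ := exists_infix_of_infix_sub_apply hab.symm ha hb
    exact hW hab h₁ h₂
  · obtain rfl : b = c := by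
      rw [Letter.eq_other_of_ne hab.symm, Letter.eq_other_of_ne (Ne.symm h)]
    obtain ⟨y, h₁, h₂⟩ := exists_infix_of_infix_sub_apply hab hb ha
    exact hW hab h₂ h₁

theorem Separated.compose {W : List Letter} (hW : Separated W) (d : ℕ → Letter) (n : ℕ) :
    Separated (compose (fun k => sub (d k)) n W) := by
  induction n generalizing W with
  | zero => exact hW
  | succ n ih => exact ih (hW.sub_apply _)

theorem separated_word (d : ℕ → Letter) (n : ℕ) (a : Letter) : Separated (word d n a) := by
  refine Separated.compose (fun x b c _ h _ => ?_) d n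
  have := h.length_le
  simp at this

/-! ### Left special factors and complexity -/

theorem exists_common_prefix_of_ne {α : Type*} {u v : List α} (hl : u.length = v.length)
    (h : u ≠ v) : ∃ x a b u' v', a ≠ b ∧ u = x ++ a :: u' ∧ v = x ++ b :: v' := by
  induction u generalizing v with
  | nil => exact absurd (List.length_eq_zero_iff.1 hl.symm).symm h
  | cons a u ih =>
    rcases v with _ | ⟨b, v⟩
    · simp at hl
    by_cases hab : a = b
    · subst hab
      obtain ⟨x, c, e, u', v', hce, rfl, rfl⟩ := ih (by simpa using hl) (by simpa using h)
      exact ⟨a :: x, c, e, u', v', hce, rfl, rfl⟩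
    · exact ⟨[], a, b, u, v, hab, rfl, rfl⟩

theorem finite_factors (w : ℕ → Letter) (n : ℕ) : (factors w n).Finite :=
  (List.finite_length_eq Letter n).subset fun u ⟨i, hi⟩ => by simp [hi]

/-- An infinite word whose prefixes are its only left special factors has complexity `n + 1`. -/
theorem isSturmian_of_leftSpecial {w : ℕ → Letter}
    (hpref : ∀ n a, a :: pref w n ∈ factors w (n + 1))
    (huniq : ∀ n u, (∀ a, a :: u ∈ factors w (n + 1)) → u = pref w n) : IsSturmian w := by
  intro n
  induction n with
  | zero =>
    have : factors w 0 = {[]} := by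
      ext u; simp [factors, block]
    rw [complexity, this, Set.ncard_singleton]
  | succ n ih =>
    -- With one of the two left extensions of the prefix removed, deleting the first letter is a
    -- bijection onto the factors of length `n`.
    suffices h : (factors w (n + 1) \ {.one :: pref w n}).ncard = (factors w n).ncard by
      rw [complexity, ← Set.ncard_sdiff_singleton_add_one (hpref n .one) (finite_factors w _), h]
      exact congrArg (· + 1) ih
    refine Set.ncard_congr (fun u _ => u.tail) ?_ ?_ ?_
    · rintro _ ⟨⟨i, rfl⟩, -⟩
      exact ⟨i + 1, by rw [block_succ]; rfl⟩
    · rintro _ _ ⟨⟨i, rfl⟩, hi⟩ ⟨⟨j, rfl⟩, hj⟩ h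
      simp only [block_succ, List.tail_cons, Set.mem_singleton_iff] at h hi hj ⊢
      by_contra hne
      have hij : w j ≠ w i := fun hw => hne (by rw [h, hw])
      have hu : block w (i + 1) n = pref w n := by
        refine huniq n _ fun a => ?_
        by_cases ha : a = w i
        · exact ⟨i, by rw [block_succ, ha]⟩
        · refine ⟨j, ?_⟩
          rw [block_succ, h, Letter.eq_other_of_ne ha, Letter.eq_other_of_ne hij]
      rw [hu] at hi
      rw [← h, hu] at hj
      cases hwi : w i
      · exact hi (by rw [hwi])
      · cases hwj : w j
        · exact hj (by rw [hwj])
        · exact hij (by rw [hwi, hwj])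
    · rintro _ ⟨i, rfl⟩
      by_cases hu : block w i n = pref w n
      · exact ⟨.two :: pref w n, ⟨hpref n _, by simp⟩, by simp [hu]⟩
      · rcases i with _ | i
        · exact absurd rfl hu
        · refine ⟨block w i (n + 1), ⟨⟨i, rfl⟩, ?_⟩, by rw [block_succ]; rfl⟩
          rw [block_succ, Set.mem_singleton_iff, List.cons.injEq]
          exact fun h => hu h.2

theorem isSturmian_of_convergesTo_word {d : ℕ → Letter} (hd : ∀ a, ∃ᶠ n in atTop, d n = a)
    {w : ℕ → Letter} (hw : ∀ a, ConvergesTo (fun n => word d n a) w)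
    (hw' : ∀ n, word d n (d n) = pref w (word d n (d n)).length) : IsSturmian w := by
  have hfac : ∀ u n a, u <:+: word d n a → u ∈ factors w u.length := by
    intro u n a h
    -- When `d m = a`, the image of `a` is itself a prefix of `w`.
    obtain ⟨m, hm, rfl⟩ := frequently_atTop.1 (hd a) n
    have := h.trans (word_suffix_word d hm _).isInfix
    rw [hw'] at this
    exact mem_factors_of_infix_pref this
  have hpref : ∀ n a, a :: pref w n ∈ factors w (n + 1) := by
    intro n a
    obtain ⟨m, hm, rfl⟩ := ((hd a).and_eventually (hw a.other n)).exists.imp fun _ h => h.symm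
    have h := hfac (d m :: pref w n) (m + 1) (d m).other ?_
    · simpa using h
    -- The first block ends in `d m` and the second begins with `pref w n`.
    · rw [word_succ_of_ne d (Letter.other_ne _)]
      obtain ⟨p, hp⟩ := singleton_suffix_word d m (d m)
      obtain ⟨q, hq⟩ := hm
      exact ⟨p, q, by dsimp only at hq; rw [← hq, ← hp]; simp⟩
  refine isSturmian_of_leftSpecial hpref fun n u hu => ?_
  by_contra hne
  have hlen : u.length = (pref w n).length := by
    obtain ⟨i, hi⟩ := hu .one
    simpa using congrArg List.length hi
  obtain ⟨x, a, b, u', v', hab, hx, hx'⟩ := exists_common_prefix_of_ne hlen hne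
  obtain ⟨i, hi⟩ := hu a
  obtain ⟨j, hj⟩ := hpref n b
  obtain ⟨m, hmi, hmj⟩ := ((hw .one (i + (n + 1))).and (hw .one (j + (n + 1)))).exists
  refine separated_word d m .one hab (x := x) ?_ ?_
  · refine List.IsInfix.trans ?_ ((block_infix_pref w i (n + 1)).trans hmi.isInfix)
    exact ⟨[], u', by rw [← hi, hx]; simp⟩
  · refine List.IsInfix.trans ?_ ((block_infix_pref w j (n + 1)).trans hmj.isInfix)
    exact ⟨[], v', by rw [← hj, hx']; simp⟩

/-! ### Letter frequencies -/

theorem count_add_count_other (a : Letter) (u : List Letter) :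
    u.count a + u.count a.other = u.length := by
  induction u with
  | nil => rfl
  | cons c u ih =>
    by_cases hc : c = a
    · subst hc
      rw [List.count_cons_self, List.count_cons_of_ne (by simp), List.length_cons]
      omega
    · rw [Letter.eq_other_of_ne hc, List.count_cons_self, List.count_cons_of_ne (by simp),
        List.length_cons]
      omega

/-- The determinant of the abelianized words is `1`. -/
theorem count_mul_length_word (d : ℕ → Letter) (n : ℕ) :
    (word d n .one).count .one * (word d n .two).length =
      (word d n .two).count .one * (word d n .one).length + 1 := by
  induction n with
  | zero => rfl
  | succ n ih =>
    cases h : d n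
    · have h₁ := word_succ_self d n
      have h₂ := word_succ_of_ne d (n := n) (a := .two) (by simp [h])
      rw [h] at h₁ h₂
      rw [h₁, h₂, List.length_append, List.count_append]
      linarith
    · have h₁ := word_succ_self d n
      have h₂ := word_succ_of_ne d (n := n) (a := .one) (by simp [h])
      rw [h] at h₁ h₂
      rw [h₁, h₂, List.length_append, List.count_append]
      linarith

/-- There is a real number strictly between the frequencies of `1` in the two images. -/
theorem exists_frequency {d : ℕ → Letter} (hd : ∀ a, ∃ᶠ n in atTop, d n = a) :
    ∃ f : ℝ, ∀ n, ((word d n .two).count .one : ℝ) < f * (word d n .two).length ∧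
      f * (word d n .one).length < (word d n .one).count .one := by
  have hpos : ∀ n a, (0 : ℝ) < (word d n a).length := fun n a => by
    exact_mod_cast length_word_pos d n a
  set lo : ℕ → ℝ := fun n => ((word d n .two).count .one : ℝ) / (word d n .two).length with hlo
  set hi : ℕ → ℝ := fun n => ((word d n .one).count .one : ℝ) / (word d n .one).length with hhi
  have hdet : ∀ n, ((word d n .one).count .one : ℝ) * (word d n .two).length =
      (word d n .two).count .one * (word d n .one).length + 1 := fun n => by
    exact_mod_cast count_mul_length_word d n
  -- Concatenation replaces one endpoint by the mediant of both, strictly inside by `hdet`.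
  have hstep_one : ∀ n, d n = .one → lo n < lo (n + 1) ∧ hi (n + 1) = hi n := by
    intro n h
    have h₁ := word_succ_self d n
    have h₂ := word_succ_of_ne d (n := n) (a := .two) (by simp [h])
    rw [h] at h₁ h₂
    refine ⟨?_, by simp only [hhi, h₁]⟩
    simp only [hlo]
    rw [div_lt_div_iff₀ (hpos _ _) (hpos _ _), h₂, List.length_append, List.count_append]
    push_cast
    linarith [hdet n]
  have hstep_two : ∀ n, d n = .two → lo (n + 1) = lo n ∧ hi (n + 1) < hi n := by
    intro n h
    have h₁ := word_succ_self d n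
    have h₂ := word_succ_of_ne d (n := n) (a := .one) (by simp [h])
    rw [h] at h₁ h₂
    refine ⟨by simp only [hlo, h₁], ?_⟩
    simp only [hhi]
    rw [div_lt_div_iff₀ (hpos _ _) (hpos _ _), h₂, List.length_append, List.count_append]
    push_cast
    linarith [hdet n]
  have hmono : Monotone lo := monotone_nat_of_le_succ fun n => by
    cases h : d n
    · exact (hstep_one n h).1.le
    · exact (hstep_two n h).1.ge
  have hanti : Antitone hi := antitone_nat_of_succ_le fun n => by
    cases h : d n
    · exact (hstep_one n h).2.le
    · exact (hstep_two n h).2.le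
  have hle : lo ≤ hi := fun n => by
    simp only [hlo, hhi]
    rw [div_le_div_iff₀ (hpos _ _) (hpos _ _)]
    linarith [hdet n]
  have hf := Set.mem_iInter.1 (hmono.ciSup_mem_iInter_Icc_of_antitone hanti hle)
  -- Each endpoint moves strictly infinitely often, hence the strict inequalities.
  refine ⟨⨆ n, lo n, fun n => ⟨?_, ?_⟩⟩
  · rw [← div_lt_iff₀ (hpos _ _)]
    obtain ⟨m, hm, h⟩ := frequently_atTop.1 (hd .one) n
    exact (hmono hm).trans_lt ((hstep_one m h).1.trans_le (hf (m + 1)).1)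
  · rw [← lt_div_iff₀ (hpos _ _)]
    obtain ⟨m, hm, h⟩ := frequently_atTop.1 (hd .two) n
    exact (hf (m + 1)).2.trans_lt ((hstep_two m h).2.trans_le (hanti hm))

theorem abs_count_sub_le_length {f : ℝ} (h₀ : 0 ≤ f) (h₁ : f ≤ 1) (u : List Letter) :
    |(u.count .one : ℝ) - f * u.length| ≤ u.length := by
  have hc : (u.count .one : ℝ) ≤ u.length := by exact_mod_cast List.count_le_length
  have hc₀ : (0 : ℝ) ≤ u.count .one := Nat.cast_nonneg _
  have hl : (0 : ℝ) ≤ u.length := Nat.cast_nonneg _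
  rw [abs_le]
  constructor <;> nlinarith

/-- Complete blocks contribute at most `ε` times their length; the last, truncated one at most `L`.
-/
theorem abs_count_sub_le_of_prefix {d : ℕ → Letter} {m : ℕ} {f ε L : ℝ} (h₀ : 0 ≤ f) (h₁ : f ≤ 1)
    (hε : 0 ≤ ε) (hL : ∀ c, ((word d m c).length : ℝ) ≤ L)
    (hw : ∀ c, |((word d m c).count .one : ℝ) - f * (word d m c).length| ≤
      ε * (word d m c).length) {u V : List Letter}
    (hu : u <+: compose (fun k => sub (d k)) m V) :
    |(u.count .one : ℝ) - f * u.length| ≤ ε * u.length + L := by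
  have hL₀ : 0 ≤ L := (Nat.cast_nonneg _).trans (hL .one)
  induction V generalizing u with
  | nil =>
    rw [compose_nil, List.prefix_nil] at hu
    simpa [hu] using hL₀
  | cons c V ih =>
    rw [compose_cons] at hu
    rcases List.prefix_or_prefix_of_prefix hu (List.prefix_append _ _) with h | ⟨v, rfl⟩
    · have hl : (u.length : ℝ) ≤ (word d m c).length := by exact_mod_cast h.length_le
      have := mul_nonneg hε (Nat.cast_nonneg (α := ℝ) u.length)
      linarith [abs_count_sub_le_length h₀ h₁ u, hL c]
    · have h := ih ((List.prefix_append_right_inj _).1 hu)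
      have hc := hw c
      rw [abs_le] at h hc ⊢
      rw [List.count_append, List.length_append]
      push_cast
      constructor <;> linarith [h.1, h.2, hc.1, hc.2]

theorem hasFrequency_one_of_convergesTo_word {d : ℕ → Letter}
    (hd : ∀ a, ∃ᶠ n in atTop, d n = a) {w : ℕ → Letter}
    (hw : ∀ n, word d n (d n) = pref w (word d n (d n)).length) {f : ℝ}
    (hf : ∀ n, ((word d n .two).count .one : ℝ) < f * (word d n .two).length ∧
      f * (word d n .one).length < (word d n .one).count .one) :
    HasFrequency w .one f := by
  have h₀ : 0 ≤ f := by simpa using (hf 0).1.le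
  have h₁ : f ≤ 1 := by simpa using (hf 0).2.le
  rw [HasFrequency, Metric.tendsto_atTop]
  intro ε hε
  obtain ⟨K, hK⟩ := exists_nat_gt (2 / ε)
  obtain ⟨m, hm₁, hm₂⟩ := ((eventually_le_length_word hd K .one).and
    (eventually_le_length_word hd K .two)).exists
  set L : ℝ := (word d m .one).length + (word d m .two).length with hL
  obtain ⟨N, hN⟩ := exists_nat_gt (2 * L / ε)
  -- By the determinant, the discrepancy of a block is less than the inverse of the other block's
  -- length, hence at most `1`; the choice of `K` makes `1` at most `ε / 2` times the length.
  have hwm : ∀ c, |((word d m c).count .one : ℝ) - f * (word d m c).length| ≤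
      ε / 2 * (word d m c).length := by
    have hdet : ((word d m .one).count .one : ℝ) * (word d m .two).length =
        (word d m .two).count .one * (word d m .one).length + 1 := by
      exact_mod_cast count_mul_length_word d m
    have hA : (K : ℝ) ≤ (word d m .one).length := by exact_mod_cast hm₁
    have hB : (K : ℝ) ≤ (word d m .two).length := by exact_mod_cast hm₂
    have hA₁ : (1 : ℝ) ≤ (word d m .one).length := by exact_mod_cast length_word_pos d m .one
    have hB₁ : (1 : ℝ) ≤ (word d m .two).length := by exact_mod_cast length_word_pos d m .two
    rw [div_lt_iff₀ hε] at hK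
    obtain ⟨hfB, hfA⟩ := hf m
    have hAε : 1 ≤ ε / 2 * (word d m .one).length := by nlinarith
    have hBε : 1 ≤ ε / 2 * (word d m .two).length := by nlinarith
    rintro (_ | _)
    · rw [abs_of_nonneg (by linarith)]
      refine le_of_mul_le_mul_right (a := ((word d m .two).length : ℝ)) ?_ (by linarith)
      nlinarith
    · rw [abs_of_nonpos (by linarith)]
      refine le_of_mul_le_mul_right (a := ((word d m .one).length : ℝ)) ?_ (by linarith)
      nlinarith
  have hLc : ∀ c, ((word d m c).length : ℝ) ≤ L := by
    rintro (_ | _) <;> simp [hL]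
  refine ⟨N + 1, fun n hn => ?_⟩
  obtain ⟨M, hM, hmM⟩ : ∃ M, m ≤ M ∧ n ≤ (word d M (d M)).length := by
    obtain ⟨M, ⟨hM₁, hM₂⟩, hM⟩ := (((eventually_le_length_word hd n .one).and
      (eventually_le_length_word hd n .two)).and (eventually_ge_atTop m)).exists
    refine ⟨M, hM, ?_⟩
    cases d M <;> assumption
  have hcomp : ∀ M, m ≤ M → ∀ u, ∃ V, compose (fun k => sub (d k)) M u =
      compose (fun k => sub (d k)) m V := by
    intro M hM
    induction M, hM using Nat.le_induction with
    | base => exact fun u => ⟨u, rfl⟩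
    | succ M _ ih => exact fun u => ih _
  obtain ⟨V, hV⟩ := hcomp M hM [d M]
  have hpre : pref w n <+: compose (fun k => sub (d k)) m V := by
    rw [← hV]
    change _ <+: word d M (d M)
    rw [hw M]
    exact pref_prefix_pref w hmM
  have key := abs_count_sub_le_of_prefix h₀ h₁ (by positivity) hLc hwm hpre
  rw [length_pref] at key
  have hNn : (N : ℝ) + 1 ≤ n := by exact_mod_cast hn
  have hn₀ : (0 : ℝ) < n := by linarith [Nat.cast_nonneg (α := ℝ) N]
  rw [Real.dist_eq, div_sub' hn₀.ne', abs_div, abs_of_pos hn₀, div_lt_iff₀ hn₀, mul_comm (n : ℝ) f]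
  rw [div_lt_iff₀ hε] at hN
  nlinarith

theorem HasFrequency.other {w : ℕ → Letter} {a : Letter} {f : ℝ} (h : HasFrequency w a f) :
    HasFrequency w a.other (1 - f) := by
  refine (h.const_sub 1).congr' ?_
  filter_upwards [eventually_gt_atTop 0] with n hn
  have h := count_add_count_other a (pref w n)
  rw [length_pref] at h
  have hn' : (n : ℝ) ≠ 0 := by exact_mod_cast hn.ne'
  field_simp
  rw [sub_eq_iff_eq_add, add_comm]
  exact_mod_cast h.symm

/-! ### Letter ratios under desubstitution -/

theorem count_sub_apply_self (a : Letter) (u : List Letter) :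
    ((sub a).apply u).count a = u.count a + u.count a.other := by
  rw [count_add_count_other]
  induction u with
  | nil => rfl
  | cons c u ih =>
    by_cases hc : c = a
    · subst hc; simp [ih]
    · rw [sub_apply_cons_of_ne hc, List.count_cons_self, List.count_cons_of_ne hc, ih,
        List.length_cons]

theorem count_sub_apply_other (a : Letter) (u : List Letter) :
    ((sub a).apply u).count a.other = u.count a.other := by
  induction u with
  | nil => rfl
  | cons c u ih =>
    by_cases hc : c = a
    · subst hc; simp [ih]
    · rw [sub_apply_cons_of_ne hc, List.count_cons_of_ne (by simp), List.count_cons,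
        List.count_cons, ih]

/-- The number `x` lies strictly between the ratios of the numbers of occurrences of `a` and of
the other letter in the images of the two letters by the substitutions directed by `d`. -/
def IsRatio (d : ℕ → Letter) (a : Letter) (x : ℝ) : Prop :=
  ∀ n, x * (word d n a).count a.other < (word d n a).count a ∧
    ((word d n a.other).count a : ℝ) < x * (word d n a.other).count a.other

namespace IsRatio

variable {d : ℕ → Letter} {a : Letter} {x : ℝ}

theorem pos (h : IsRatio d a x) : 0 < x := by
  simpa using (h 0).2

theorem flip (h : IsRatio d a x) : IsRatio d a.other x⁻¹ := by
  intro n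
  rw [Letter.other_other, inv_mul_lt_iff₀ h.pos, lt_inv_mul_iff₀ h.pos]
  exact ⟨(h n).2, (h n).1⟩

theorem shift (h : IsRatio d a x) (hd : d 0 = a) : IsRatio (fun k => d (k + 1)) a (x - 1) := by
  intro n
  have := h (n + 1)
  simp only [word_succ_left, hd, count_sub_apply_self, count_sub_apply_other] at this
  push_cast at this
  constructor <;> linarith [this.1, this.2]

theorem shift_run {k : ℕ} (h : IsRatio d a x) (hd : ∀ i < k, d i = a) :
    IsRatio (fun i => d (i + k)) a (x - k) := by
  induction k with
  | zero => simpa using h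
  | succ k ih =>
    have := (ih fun i hi => hd i (by omega)).shift (by simpa using hd k (by omega))
    have he : (fun i => d (i + (k + 1))) = fun i => d (i + 1 + k) := by
      funext i
      congr 1
      omega
    rw [Nat.cast_succ, ← sub_sub, he]
    exact this

/-- The inverse ratio can be lowered by one and remains positive. -/
theorem lt_one (h : IsRatio d a x) (hd : d 0 ≠ a) : x < 1 := by
  have := (h.flip.shift (Letter.eq_other_of_ne hd)).pos
  rw [sub_pos, one_lt_inv₀ h.pos] at this
  exact this

end IsRatio

/-! ### Runs and the continued fraction -/

/-- The letter fixed by the substitution of the `k`-th run. -/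
def runLetter (k : ℕ) : Letter := if Even k then .one else .two

theorem runLetter_succ (k : ℕ) : runLetter (k + 1) = (runLetter k).other := by
  by_cases h : Even k <;> simp [runLetter, Nat.even_add_one, h, Letter.other]

theorem runValue_eq_sub (k : ℕ) : runValue k = sub (runLetter k) := by
  by_cases h : Even k <;> simp [runLetter, runValue, h, sub_one, sub_two]

section Runs

variable {d : ℕ → Letter}

theorem runStart_succ_spec (hd : ∀ a, ∃ᶠ n in atTop, d n = a) (k : ℕ) :
    runStart (fun n => sub (d n)) k ≤ runStart (fun n => sub (d n)) (k + 1) ∧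
      d (runStart (fun n => sub (d n)) (k + 1)) ≠ runLetter k := by
  -- Nonemptiness keeps `sInf` from its default value `0`.
  have hne : {n | runStart (fun n => sub (d n)) k ≤ n ∧ sub (d n) ≠ runValue k}.Nonempty := by
    obtain ⟨n, hn, h⟩ := frequently_atTop.1 (hd (runLetter k).other) (runStart _ k)
    exact ⟨n, hn, by rw [h, runValue_eq_sub]; exact fun h => by simpa using sub_injective h⟩
  have h := Nat.sInf_mem hne
  exact ⟨h.1, fun h' => h.2 ((congrArg sub h').trans (runValue_eq_sub k).symm)⟩

theorem eq_runLetter_of_lt_runLength {k i : ℕ} (hi : i < runLength (fun n => sub (d n)) k) :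
    d (i + runStart (fun n => sub (d n)) k) = runLetter k := by
  by_contra h
  refine Nat.notMem_of_lt_sInf (m := i + runStart (fun n => sub (d n)) k)
    (s := {n | runStart (fun n => sub (d n)) k ≤ n ∧ sub (d n) ≠ runValue k}) ?_ ⟨by omega, ?_⟩
  · change _ < runStart _ (k + 1)
    rw [runLength] at hi
    omega
  · rw [runValue_eq_sub]
    exact fun h' => h (sub_injective h')

/-- At the start of a run, the integer part of the ratio is the length of the run. -/
theorem IsRatio.floor_run (hd : ∀ a, ∃ᶠ n in atTop, d n = a) {k : ℕ} {x : ℝ}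
    (h : IsRatio (fun i => d (i + runStart (fun n => sub (d n)) k)) (runLetter k) x) :
    ⌊x⌋ = runLength (fun n => sub (d n)) k ∧ Int.fract x ≠ 0 ∧
      IsRatio (fun i => d (i + runStart (fun n => sub (d n)) (k + 1))) (runLetter (k + 1))
        (Int.fract x)⁻¹ := by
  obtain ⟨hle, hne⟩ := runStart_succ_spec hd k
  have hs : runLength (fun n => sub (d n)) k + runStart (fun n => sub (d n)) k =
      runStart (fun n => sub (d n)) (k + 1) := by
    rw [runLength]; omega
  have hr := h.shift_run fun i hi => eq_runLetter_of_lt_runLength hi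
  simp only [Nat.add_assoc, hs] at hr
  -- Once the run is removed, the remainder is positive, and below `1` because the next letter
  -- differs: it is the fractional part.
  have h₀ := hr.pos
  have h₁ := hr.lt_one (by simpa using hne)
  have hfl : ⌊x⌋ = runLength (fun n => sub (d n)) k := by
    rw [Int.floor_eq_iff]
    push_cast
    constructor <;> linarith
  have hfr : Int.fract x = x - runLength (fun n => sub (d n)) k := by
    rw [Int.fract, hfl, Int.cast_natCast]
  rw [hfr, runLetter_succ]
  exact ⟨hfl, h₀.ne', hr.flip⟩

open GenContFract in
theorem isContFractExpansion_of_isRatio (hd : ∀ a, ∃ᶠ n in atTop, d n = a) {x : ℝ}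
    (hx : IsRatio d .one x) : IsContFractExpansion (runLength fun n => sub (d n)) x := by
  -- The `n`-th complete quotient is the letter ratio for the sequence starting at run `n`.
  have key : ∀ n, ∃ y, IntFractPair.stream x n = some (IntFractPair.of y) ∧
      IsRatio (fun i => d (i + runStart (fun n => sub (d n)) n)) (runLetter n) y := by
    intro n
    induction n with
    | zero => exact ⟨x, rfl, hx⟩
    | succ n ih =>
      obtain ⟨y, hy, hr⟩ := ih
      obtain ⟨-, h₀, h⟩ := hr.floor_run hd
      exact ⟨_, IntFractPair.stream_succ_of_some hy h₀, h⟩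
  constructor
  · rw [of_h_eq_floor, (IsRatio.floor_run (k := 0) hd hx).1, Int.cast_natCast]
  · intro n
    obtain ⟨y, hy, hr⟩ := key (n + 1)
    rw [get?_of_eq_some_of_succ_get?_intFractPair_stream hy]
    simp [IntFractPair.of, (hr.floor_run hd).1]

end Runs

theorem isRatio_of_frequency {d : ℕ → Letter} {f : ℝ}
    (hf : ∀ n, ((word d n .two).count .one : ℝ) < f * (word d n .two).length ∧
      f * (word d n .one).length < (word d n .one).count .one) :
    IsRatio d .one (f / (1 - f)) := by
  -- At `n = 0` the image of `1` is a single letter, so the bound reads `f < 1`.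
  have h₁ : 0 < 1 - f := by simpa using (hf 0).2
  intro n
  have hl : ∀ u : List Letter, (u.length : ℝ) = u.count .one + u.count .two := fun u => by
    exact_mod_cast (count_add_count_other .one u).symm
  have := hf n
  rw [hl, hl] at this
  simp only [Letter.other]
  rw [div_mul_eq_mul_div, div_mul_eq_mul_div, div_lt_iff₀ h₁, lt_div_iff₀ h₁]
  constructor <;> linarith [this.1, this.2]

end SturmianWords

theorem mainTheorem7 (s : ℕ → Substitution)
    (hs : ∀ n, s n = sigma1 ∨ s n = sigma2)
    (h1 : ∃ᶠ n in atTop, s n = sigma1)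
    (h2 : ∃ᶠ n in atTop, s n = sigma2) :
    ∃ w₀ : ℕ → Letter,
      ConvergesTo (fun n => compose s n [Letter.one]) w₀ ∧
      ConvergesTo (fun n => compose s n [Letter.two]) w₀ ∧
      IsSturmian w₀ ∧
      ∃ f₁ f₂ : ℝ,
        HasFrequency w₀ Letter.one f₁ ∧
        HasFrequency w₀ Letter.two f₂ ∧
        f₂ ≠ 0 ∧
        IsContFractExpansion (runLength s) (f₁ / f₂) := by
  obtain ⟨d, rfl⟩ : ∃ d : ℕ → Letter, s = fun n => sub (d n) := by
    have : ∀ n, ∃ a, s n = sub a := fun n =>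
      (hs n).elim (fun h => ⟨.one, h.trans sub_one.symm⟩) fun h => ⟨.two, h.trans sub_two.symm⟩
    choose d hd using this
    exact ⟨d, funext hd⟩
  have hd : ∀ a, ∃ᶠ n in atTop, d n = a := by
    rintro (_ | _)
    · exact h1.mono fun n h => sub_injective (h.trans sub_one.symm)
    · exact h2.mono fun n h => sub_injective (h.trans sub_two.symm)
  obtain ⟨w, hw, hw'⟩ := exists_convergesTo_word hd
  obtain ⟨f, hf⟩ := exists_frequency hd
  have hfreq := hasFrequency_one_of_convergesTo_word hd hw' hf
  have hf₁ : f < 1 := by simpa using (hf 0).2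
  exact ⟨w, hw .one, hw .two, isSturmian_of_convergesTo_word hd hw hw', f, 1 - f, hfreq,
    hfreq.other, (sub_pos.2 hf₁).ne',
    isContFractExpansion_of_isRatio hd (isRatio_of_frequency hf)⟩
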